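/- Let $G$ be a graph. A configuration of $t$ pebbles on $G$ is a function $C:V(G)\to\mathbb{Z}_{\ge 0}$ with $\sum_{v}C(v)=t$. A pebbling move removes two pebbles from some vertex and places one of them on an adjacent vertex. A configuration is cover solvable if some finite (possibly empty) sequence of pebbling moves starting from it leads to a configuration with at least one pebble on every vertex simultaneously. In the Bose–Einstein model, each of the $\binom{n+t-1}{n-1}$ configurations of $t$ pebbles on the $n$ vertices of the complete graph $K_n$ is equally likely; let $P(n,t)$ denote the probability that the resulting random configuration on $K_n$ is cover solvable. Let $\gamma=(1+\sqrt5)/2$ be the golden ratio, let $\varphi:\mathbb{N}\to\mathbb{R}$ be an arbitrary function with $\varphi(n)\to\infty$ as $n\to\infty$, and let $(t_n)$ be a sequence of non-negative integers. 1. If $t_n=\gamma n+\varphi(n)\sqrt n$ for all sufficiently large $n$, then $P(n,t_n)\to1$ as $n\to\infty$. 2. If $t_n=\gamma n-\varphi(n)\sqrt n$ for all sufficiently large $n$, then $P(n,t_n)\to0$ as $n\to\infty$. Here the equations for the integers $t_n$ are understood up to rounding: it is enough that the two sides differ by less than $1$ (so equality, rounding down and rounding up are all allowed). -/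

import Mathlib

open Filter Topology MeasureTheory

namespace CoverPebbling

/-- A configuration of pebbles on the vertex set `V`: the number of pebbles on each vertex. -/
abbrev Configuration (V : Type*) := V → ℕ

/-- `PebblingMove G C D`: the configuration `D` arises from `C` by one pebbling move, that is, two
pebbles are removed from a vertex `u` and one of them is placed on a vertex `v` adjacent to `u`. -/
def PebblingMove {V : Type*} [DecidableEq V] (G : SimpleGraph V) (C D : Configuration V) : Prop :=
  ∃ u v : V, G.Adj u v ∧ 2 ≤ C u ∧ D = C - Pi.single u 2 + Pi.single v 1

/-- A configuration is cover solvable if some finite sequence of pebbling moves, starting from it,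
leads to a configuration with at least one pebble on every vertex simultaneously. -/
def CoverSolvable {V : Type*} [DecidableEq V] (G : SimpleGraph V) (C : Configuration V) : Prop :=
  ∃ D : Configuration V, Relation.ReflTransGen (PebblingMove G) C D ∧ ∀ v, 1 ≤ D v

/-- The Bose-Einstein distribution of `t` indistinguishable pebbles on `V`: the uniform
distribution on the configurations of weight `t`. -/
noncomputable def boseEinstein (V : Type*) [Fintype V] (t : ℕ) : Measure (Configuration V) :=
  ProbabilityTheory.uniformOn {C | ∑ v, C v = t}

/-- The probability that the complete graph on `n` vertices is cover solvable when `t`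
indistinguishable pebbles are placed on it according to the Bose-Einstein distribution. -/
noncomputable def probCoverSolvable (n t : ℕ) : ℝ :=
  (boseEinstein (Fin n) t).real {C | CoverSolvable (⊤ : SimpleGraph (Fin n)) C}

end CoverPebbling

/-! On `K_n` the quantity `∑ ⌈C v / 2⌉` never increases, and a configuration can be covered exactly
when it is at least `n`. Writing `m = ∑ ⌊C v / 2⌋` for the number of pairs, this says `m ≤ t - n`
(`coverSolvable_top_iff_sum_div_two`). There are `choose n x * multichoose n m` configurations with
`m` pairs and `x = t - 2m` odd vertices. Put `β = γ - 1`, so `β² = 1 - β`. At `t = γn`, `m = t - n =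
βn`, `x = β²n`, the ratio of consecutive fibres is about `x²(m + n) / ((n - x)² m) = β(β + 1) = 1`:
the mode sits at the threshold. If `t` is off by `k`, the ratio is at most `exp(-k/(2n))` within
`k/4` steps of the threshold and throughout the bad side. Shifting the bad fibres by about `k/4`
bounds their share by `exp(-k²/(16n))`, which vanishes once `k/√n → ∞`. -/

namespace CoverPebbling

open Finset

/-! ### Cover solvability on complete graphs -/

section Solvability

variable {V : Type*} [DecidableEq V] [Fintype V]

/-- A pebbling move does not increase `∑ v, ⌈C v / 2⌉`. -/
lemma PebblingMove.sum_half_le {G : SimpleGraph V} {C D : Configuration V}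
    (h : PebblingMove G C D) : ∑ v, (D v + 1) / 2 ≤ ∑ v, (C v + 1) / 2 := by
  obtain ⟨u, v, huv, hu, rfl⟩ := h
  have hne : u ≠ v := huv.ne
  -- Adding the indicators of `u` and `v`, whose sums agree, avoids subtraction in `ℕ`.
  rw [← add_le_add_iff_right (∑ w, (Pi.single u 1 : V → ℕ) w), ← sum_add_distrib]
  have hsum : ∑ w, (Pi.single u 1 : V → ℕ) w = ∑ w, (Pi.single v 1 : V → ℕ) w := by simp
  rw [hsum, ← sum_add_distrib]
  refine sum_le_sum fun w _ => ?_
  rcases eq_or_ne w u with rfl | hwu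
  · simp [hne]; omega
  · rcases eq_or_ne w v with rfl | hwv
    · simp [hwu]; omega
    · simp [hwu, hwv]

/-- If `∑ v, ⌈C v / 2⌉` is at least the number of vertices, a complete graph can be covered. -/
lemma coverSolvable_top_of_card_le (C : Configuration V)
    (h : Fintype.card V ≤ ∑ v, (C v + 1) / 2) : CoverSolvable (⊤ : SimpleGraph V) C := by
  induction hz : #{v | C v = 0} generalizing C with
  | zero =>
    refine ⟨C, .refl, fun v => Nat.one_le_iff_ne_zero.2 fun hv => ?_⟩
    rw [card_eq_zero, filter_eq_empty_iff] at hz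
    exact hz (mem_univ v) hv
  | succ k ih =>
    obtain ⟨v, hv⟩ := card_pos.1 (show 0 < #{v | C v = 0} by omega)
    have hv0 : C v = 0 := (mem_filter.1 hv).2
    -- A vertex with three pebbles can pay for `v` and stay covered, so the number of empty vertices
    -- drops by one.
    obtain ⟨u, hu⟩ : ∃ u, 3 ≤ C u := by
      by_contra! hlt
      have : ∑ w, (C w + 1) / 2 < ∑ _w : V, 1 :=
        sum_lt_sum (fun w _ => by have := hlt w; omega) ⟨v, mem_univ v, by omega⟩
      simp at this
      omega
    have huv : u ≠ v := by rintro rfl; omega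
    let D : Configuration V := C - Pi.single u 2 + Pi.single v 1
    have hmove : PebblingMove ⊤ C D := ⟨u, v, huv, by omega, rfl⟩
    have hD : ∀ w, D w = if w = u then C u - 2 else if w = v then 1 else C w := by
      intro w
      rcases eq_or_ne w u with rfl | hwu
      · simp [D, huv]
      · rcases eq_or_ne w v with rfl | hwv
        · simp [D, hwu, hv0]
        · simp [D, hwu, hwv]
    have hsum : ∑ w, (D w + 1) / 2 = ∑ w, (C w + 1) / 2 := by
      have h1 : ∑ w, ((D w + 1) / 2 + (Pi.single u 1 : V → ℕ) w)
          = ∑ w, ((C w + 1) / 2 + (Pi.single v 1 : V → ℕ) w) := by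
        refine sum_congr rfl fun w _ => ?_
        rw [hD]
        rcases eq_or_ne w u with rfl | hwu
        · simp [huv]; omega
        · rcases eq_or_ne w v with rfl | hwv
          · simp [hwu, hv0]
          · simp [hwu, hwv]
      simpa [sum_add_distrib] using h1
    have hzeros : ({w | D w = 0} : Finset V) = ({w | C w = 0} : Finset V).erase v := by
      ext w
      simp only [mem_filter, mem_univ, true_and, mem_erase, hD]
      split_ifs with h1 h2
      · subst h1; omega
      · simp [h2]
      · simp [h2]
    obtain ⟨E, hE, hE1⟩ := ih D (hsum ▸ h) (by rw [hzeros, card_erase_of_mem hv, hz]; rfl)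
    exact ⟨E, .head hmove hE, hE1⟩

lemma coverSolvable_top_iff (C : Configuration V) :
    CoverSolvable (⊤ : SimpleGraph V) C ↔ Fintype.card V ≤ ∑ v, (C v + 1) / 2 := by
  refine ⟨?_, coverSolvable_top_of_card_le C⟩
  rintro ⟨D, hCD, hD⟩
  have hle : ∑ v, (D v + 1) / 2 ≤ ∑ v, (C v + 1) / 2 := by
    clear hD
    induction hCD with
    | refl => exact le_rfl
    | tail _ h ih => exact h.sum_half_le.trans ih
  calc Fintype.card V = ∑ _v : V, 1 := by simp
    _ ≤ ∑ v, (D v + 1) / 2 := sum_le_sum fun v _ => by have := hD v; omega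
    _ ≤ _ := hle

/-- On a complete graph, cover solvability depends only on the number of pebbles and on the
number of disjoint pairs of pebbles lying on a common vertex. -/
lemma coverSolvable_top_iff_sum_div_two (C : Configuration V) :
    CoverSolvable (⊤ : SimpleGraph V) C ↔ ∑ v, C v / 2 + Fintype.card V ≤ ∑ v, C v := by
  have h : ∑ v, C v = ∑ v, C v / 2 + ∑ v, (C v + 1) / 2 := by
    rw [← sum_add_distrib]
    exact sum_congr rfl fun v _ => by omega
  rw [coverSolvable_top_iff, h]
  omega

end Solvability

/-! ### Fibre sizes and their ratios -/

section Counting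

lemma card_finAntidiagonal_eq_multichoose (n m : ℕ) :
    #(finAntidiagonal n m) = n.multichoose m := by
  have h : finAntidiagonal n m = piAntidiag (univ : Finset (Fin n)) m := by
    ext; simp
  rw [h, ← map_sym_eq_piAntidiag, card_map, sym_univ, card_univ,
    Sym.card_sym_eq_multichoose, Fintype.card_fin]

/-- The number of configurations with `x` odd entries and `m` disjoint pairs of pebbles. -/
lemma card_filter_sum_div_two (n x m : ℕ) :
    #{C ∈ finAntidiagonal n (x + 2 * m) | ∑ v, C v / 2 = m} = n.choose x * n.multichoose m := by
  have hcard : n.choose x = #((univ : Finset (Fin n)).powersetCard x) := by simp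
  rw [hcard, ← card_finAntidiagonal_eq_multichoose, ← card_product]
  have key : ∀ C : Fin n → ℕ, ∑ v, C v = #{v | C v % 2 = 1} + 2 * ∑ v, C v / 2 := by
    intro C
    rw [card_filter, mul_sum, ← sum_add_distrib]
    exact sum_congr rfl fun v _ => by split_ifs <;> omega
  -- A configuration is determined by its set of odd vertices and its halves rounded down.
  refine card_bij' (fun C _ => (({v | C v % 2 = 1} : Finset (Fin n)), fun v => C v / 2))
    (fun p _ v => 2 * p.2 v + if v ∈ p.1 then 1 else 0) ?_ ?_ ?_ ?_
  · intro C hC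
    rw [mem_filter, mem_finAntidiagonal] at hC
    have := key C
    simp only [mem_product, mem_powersetCard, subset_univ, true_and, mem_finAntidiagonal]
    omega
  · intro p hp
    simp only [mem_product, mem_powersetCard, subset_univ, true_and, mem_finAntidiagonal] at hp
    have h2 : ∀ v, (2 * p.2 v + if v ∈ p.1 then 1 else 0) / 2 = p.2 v := by
      intro v; split_ifs <;> omega
    simp only [mem_filter, mem_finAntidiagonal, h2, sum_add_distrib, ← mul_sum, hp.2, and_true]
    simp [hp.1]
    omega
  · intro C _
    funext v
    simp only [mem_filter, mem_univ, true_and]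
    split_ifs <;> omega
  · intro p _
    refine Prod.ext ?_ ?_
    · ext v
      simp only [mem_filter, mem_univ, true_and]
      split_ifs with h <;> simp [h]
    · funext v
      dsimp only
      split_ifs <;> omega

lemma card_filter_sum_div_two_eq_zero {n t m : ℕ} (h : t < 2 * m) :
    #{C ∈ finAntidiagonal n t | ∑ v, C v / 2 = m} = 0 := by
  rw [card_eq_zero, filter_eq_empty_iff]
  intro C hC hm
  rw [mem_finAntidiagonal] at hC
  have : 2 * ∑ v, C v / 2 ≤ ∑ v, C v := by
    rw [mul_sum]
    exact sum_le_sum fun v _ => by omega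
  omega

lemma succ_mul_multichoose_succ (n m : ℕ) :
    (m + 1) * n.multichoose (m + 1) = (m + n) * n.multichoose m := by
  rcases n with _ | n
  · rcases m with _ | m <;> simp
  · rw [Nat.multichoose_eq, Nat.multichoose_eq]
    have h := Nat.add_one_mul_choose_eq (n + m) m
    have e1 : n + 1 + (m + 1) - 1 = n + m + 1 := by omega
    have e2 : n + 1 + m - 1 = n + m := by omega
    rw [e1, e2]
    linarith

lemma choose_add_two_mul (n x : ℕ) :
    (x + 1) * (x + 2) * n.choose (x + 2) = (n - x) * (n - x - 1) * n.choose x := by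
  have h1 := Nat.choose_succ_right_eq n x
  have h2 := Nat.choose_succ_right_eq n (x + 1)
  rw [show n - (x + 1) = n - x - 1 by omega] at h2
  calc (x + 1) * (x + 2) * n.choose (x + 2) =
        (x + 1) * (n.choose (x + 1 + 1) * (x + 1 + 1)) := by ring
    _ = (n.choose (x + 1) * (x + 1)) * (n - x - 1) := by rw [h2]; ring
    _ = _ := by rw [h1]; ring

/-- The ratio of consecutive fibres at fixed `t`: one more pair means two fewer odd vertices. -/
lemma choose_mul_multichoose_step (n x m : ℕ) :
    (x + 1) * (x + 2) * (m + n) * (n.choose (x + 2) * n.multichoose m) =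
      (n - x) * (n - x - 1) * (m + 1) * (n.choose x * n.multichoose (m + 1)) := by
  calc _ = ((x + 1) * (x + 2) * n.choose (x + 2)) * ((m + n) * n.multichoose m) := by ring
    _ = _ := by rw [choose_add_two_mul, ← succ_mul_multichoose_succ]; ring

/-- If a fibre over `m` satisfying `p` is at most `r` times the fibre over `g m`, and `g` is
injective on `p`, then at most the proportion `r` of the elements lies over `p`. -/
lemma card_filter_le_mul_card {ι κ : Type*} [DecidableEq κ] (S : Finset ι) (f : ι → κ) (p : κ → Prop)
    [DecidablePred p] (g : κ → κ) (hg : Set.InjOn g {m | p m}) (r : ℝ) (hr : 0 ≤ r)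
    (h : ∀ m, p m → (#{C ∈ S | f C = m} : ℝ) ≤ r * #{C ∈ S | f C = g m}) :
    (#{C ∈ S | p (f C)} : ℝ) ≤ r * #S := by
  set T := {m ∈ S.image f | p m} with hT
  have h1 : #{C ∈ S | p (f C)} = ∑ m ∈ T, #{C ∈ S | f C = m} := by
    rw [sum_card_fiberwise_eq_card_filter]
    congr 1
    refine filter_congr fun C hC => ?_
    simp only [hT, mem_filter, mem_image]
    exact ⟨fun hp => ⟨⟨C, hC, rfl⟩, hp⟩, fun hp => hp.2⟩
  have h2 : ∑ m ∈ T, #{C ∈ S | f C = g m} ≤ #S := by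
    rw [← sum_image (s := T) (g := g) (f := fun m => #{C ∈ S | f C = m}),
      sum_card_fiberwise_eq_card_filter]
    · exact card_filter_le _ _
    · exact hg.mono fun m hm => (mem_filter.1 hm).2
  calc (#{C ∈ S | p (f C)} : ℝ) = ∑ m ∈ T, (#{C ∈ S | f C = m} : ℝ) := by rw [h1]; push_cast; rfl
    _ ≤ ∑ m ∈ T, r * (#{C ∈ S | f C = g m} : ℝ) :=
      sum_le_sum fun m hm => h m (mem_filter.1 hm).2
    _ = r * ((∑ m ∈ T, #{C ∈ S | f C = g m} : ℕ) : ℝ) := by rw [← mul_sum]; push_cast; rfl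
    _ ≤ r * #S := by gcongr

end Counting

/-! ### The probability as a quotient of counts -/

section Probability

lemma coe_finAntidiagonal (n t : ℕ) :
    (finAntidiagonal n t : Set (Fin n → ℕ)) = {C | ∑ v, C v = t} := by
  ext; simp

lemma finAntidiagonal_nonempty {n : ℕ} (hn : 0 < n) (t : ℕ) : (finAntidiagonal n t).Nonempty :=
  ⟨Pi.single ⟨0, hn⟩ t, by simp⟩

lemma probCoverSolvable_eq_div (n t : ℕ) :
    probCoverSolvable n t =
      (#{C ∈ finAntidiagonal n t | ∑ v, C v / 2 + n ≤ t} : ℝ) / #(finAntidiagonal n t) := by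
  have hset : (({C ∈ finAntidiagonal n t | ∑ v, C v / 2 + n ≤ t} : Finset _) : Set (Fin n → ℕ)) =
      (finAntidiagonal n t : Set (Fin n → ℕ)) ∩ {C | CoverSolvable (⊤ : SimpleGraph (Fin n)) C} := by
    ext C
    simp only [coe_filter, mem_finAntidiagonal, Set.mem_ofPred_eq, Set.mem_inter_iff, mem_coe,
      coverSolvable_top_iff_sum_div_two, Fintype.card_fin]
    exact and_congr_right fun h => by rw [h]
  rw [probCoverSolvable, boseEinstein, ← coe_finAntidiagonal, measureReal_def,
    ← ProbabilityTheory.uniformOn_inter_self (finite_toSet _), ← hset,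
    ProbabilityTheory.uniformOn_apply_finset, inter_eq_right.2 (filter_subset _ _)]
  simp

end Probability

/-! ### Ratio estimates around the golden ratio -/

section Ratio

/-- Here `y` plays the number of odd vertices and `s` the number of pairs. Equality holds at `y =
β²n`, `s = βn`, `k = 0`; the deficit `k/2` in `y` yields the factor `1 - k/(2n)`. -/
lemma sq_mul_add_le_of_add_le {β n k y s : ℝ} (hβ : 0 < β) (hβ2 : β ^ 2 = 1 - β) (hn : 0 < n)
    (hk : 0 ≤ k) (hy : 0 ≤ y) (hyle : y ≤ β ^ 2 * n - k / 2) (hs : β * n ≤ s) :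
    y ^ 2 * (s + n) ≤ (1 - k / (2 * n)) * ((n - y) ^ 2 * s) := by
  obtain ⟨q, hq⟩ : ∃ q, q = 1 - k / (2 * n) := ⟨_, rfl⟩
  have hkq : k / 2 = n * (1 - q) := by rw [hq]; field_simp; ring
  rw [← hq]
  have hq1 : 0 ≤ 1 - q := nonneg_of_mul_nonneg_right (hkq ▸ by positivity) hn
  have hβn : 0 < β ^ 2 * n := by positivity
  have hy1 : y ≤ β ^ 2 * n * q := by
    nlinarith [mul_nonneg (mul_nonneg hβ.le hn.le) hq1]
  have hq0 : 0 ≤ q := nonneg_of_mul_nonneg_right (hy.trans hy1) hβn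
  have hv : β * n ≤ n - y := by nlinarith [mul_nonneg hn.le hq1]
  have hyv : y ≤ β * q * (n - y) := by
    calc y ≤ β * q * (β * n) := by linarith [hy1]
      _ ≤ _ := by gcongr
  have hy2 : y ^ 2 ≤ β ^ 2 * q * (n - y) ^ 2 := by
    calc y ^ 2 ≤ (β * q * (n - y)) ^ 2 := by gcongr
      _ = β ^ 2 * (n - y) ^ 2 * q * q := by ring
      _ ≤ β ^ 2 * (n - y) ^ 2 * q * 1 := by gcongr; linarith
      _ = _ := by ring
  have hs0 : 0 < s := lt_of_lt_of_le (by positivity) hs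
  have hsn : β ^ 2 * (s + n) ≤ s := by nlinarith [mul_le_mul_of_nonneg_left hs hβ.le]
  calc y ^ 2 * (s + n) ≤ β ^ 2 * q * (n - y) ^ 2 * (s + n) := by gcongr
    _ = q * (n - y) ^ 2 * (β ^ 2 * (s + n)) := by ring
    _ ≤ q * (n - y) ^ 2 * s := by gcongr
    _ = _ := by ring

/-- The mirror estimate below the threshold, with `u` the number of even vertices, critical at `βn`.
-/
lemma sq_mul_le_of_le_sub {β n k u s : ℝ} (hβ : 0 < β) (hβ2 : β ^ 2 = 1 - β) (hn : 0 < n)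
    (hk : 0 ≤ k) (hu : 0 ≤ u) (hule : u ≤ β * n - k / 2) (hs0 : 0 ≤ s) (hs : s ≤ β * n) :
    u ^ 2 * s ≤ (1 - k / (2 * n)) * ((n - u) ^ 2 * (s + n)) := by
  obtain ⟨q, hq⟩ : ∃ q, q = 1 - k / (2 * n) := ⟨_, rfl⟩
  have hkq : k / 2 = n * (1 - q) := by rw [hq]; field_simp; ring
  rw [← hq]
  have hq1 : 0 ≤ 1 - q := nonneg_of_mul_nonneg_right (hkq ▸ by positivity) hn
  have hβ1 : 0 ≤ 1 - β := hβ2 ▸ sq_nonneg β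
  have hu1 : u ≤ β * n * q := by
    nlinarith [mul_nonneg hβ1 (mul_nonneg hn.le hq1)]
  have hq0 : 0 ≤ q := nonneg_of_mul_nonneg_right (hu.trans hu1) (by positivity)
  have hx : β ^ 2 * n ≤ n - u := by nlinarith [mul_nonneg hn.le hq1]
  have hux : β * u ≤ q * (n - u) := by
    calc β * u ≤ β * (β * n * q) := by gcongr
      _ = q * (β ^ 2 * n) := by ring
      _ ≤ _ := by gcongr
  have hu2 : β ^ 2 * u ^ 2 ≤ q * (n - u) ^ 2 := by
    calc β ^ 2 * u ^ 2 = (β * u) ^ 2 := by ring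
      _ ≤ (q * (n - u)) ^ 2 := by gcongr
      _ = q * (n - u) ^ 2 * q := by ring
      _ ≤ q * (n - u) ^ 2 * 1 := by gcongr; linarith
      _ = _ := by ring
  have hsn : s ≤ β ^ 2 * (s + n) := by nlinarith [mul_le_mul_of_nonneg_left hs hβ.le]
  calc u ^ 2 * s ≤ u ^ 2 * (β ^ 2 * (s + n)) := by gcongr
    _ = β ^ 2 * u ^ 2 * (s + n) := by ring
    _ ≤ q * (n - u) ^ 2 * (s + n) := by gcongr
    _ = _ := by ring

lemma goldenRatio_sub_one_sq : (Real.goldenRatio - 1) ^ 2 = 1 - (Real.goldenRatio - 1) := by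
  linear_combination Real.goldenRatio_sq

lemma choose_mul_multichoose_step_real {n x m : ℕ} (hx : x < n) :
    ((x : ℝ) + 1) * (x + 2) * (m + n) * ((n.choose (x + 2) * n.multichoose m : ℕ) : ℝ) =
      (n - x) * (n - x - 1) * (m + 1) * ((n.choose x * n.multichoose (m + 1) : ℕ) : ℝ) := by
  have h := choose_mul_multichoose_step n x m
  rw [← @Nat.cast_inj ℝ] at h
  push_cast [Nat.cast_sub hx.le, Nat.cast_sub (show 1 ≤ n - x by omega)] at h
  push_cast
  exact h

lemma one_sub_div_le_exp (n : ℕ) (k : ℝ) : 1 - k / (2 * n) ≤ Real.exp (-(k / (2 * n))) := by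
  linarith [Real.add_one_le_exp (-(k / (2 * n)))]

/-- Above the golden ratio threshold the fibre sizes decay geometrically for `m` above the
critical number of pairs. -/
lemma card_fiber_succ_le {n t m a : ℕ} {k : ℝ} (hn : 0 < n) (hk : 0 ≤ k)
    (ht : Real.goldenRatio * n + k ≤ t) (ha : 4 * (a : ℝ) ≤ k) (hm : t < m + n + a) :
    (#{C ∈ finAntidiagonal n t | ∑ v, C v / 2 = m + 1} : ℝ) ≤
      Real.exp (-(k / (2 * n))) * #{C ∈ finAntidiagonal n t | ∑ v, C v / 2 = m} := by
  rcases lt_or_ge t (2 * (m + 1)) with hlt | hge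
  · rw [card_filter_sum_div_two_eq_zero hlt, Nat.cast_zero]
    positivity
  obtain ⟨x, rfl⟩ : ∃ x, t = x + 2 * (m + 1) := ⟨t - 2 * (m + 1), by omega⟩
  rw [card_filter_sum_div_two, show x + 2 * (m + 1) = x + 2 + 2 * m by ring,
    card_filter_sum_div_two]
  have hβ : 0 < Real.goldenRatio - 1 := by linarith [Real.one_lt_goldenRatio]
  have hn' : (0 : ℝ) < n := by exact_mod_cast hn
  have hm' : (x : ℝ) + 2 * (m + 1) + 1 ≤ m + n + a := by exact_mod_cast hm
  push_cast at ht
  -- Moving `a` fibres changes the odd count by `2a ≤ k/2`, so half of the margin `k` survives.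
  have hyle : (x : ℝ) + 2 ≤ (Real.goldenRatio - 1) ^ 2 * n - k / 2 := by
    rw [goldenRatio_sub_one_sq]; linarith
  have main := sq_mul_add_le_of_add_le (s := m + 1) hβ goldenRatio_sub_one_sq hn' hk
    (by positivity) hyle (by linarith)
  have hxn : (x : ℝ) + 2 < n := by
    nlinarith [goldenRatio_sub_one_sq]
  have hxn' : x + 2 < n := by exact_mod_cast hxn
  have step := choose_mul_multichoose_step_real (m := m) (show x < n by omega)
  have hpos : (0 : ℝ) < (n - x) * (n - x - 1) * (m + 1) := by
    have : (0 : ℝ) < n - x - 1 := by linarith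
    have : (0 : ℝ) < n - x := by linarith
    positivity
  refine le_of_mul_le_mul_left ?_ hpos
  rw [← step, ← mul_assoc]
  refine mul_le_mul_of_nonneg_right ?_ (Nat.cast_nonneg _)
  calc ((x : ℝ) + 1) * (x + 2) * (m + n) ≤ (x + 2) * (x + 2) * (m + 1 + n) := by
        gcongr <;> linarith
    _ = (x + 2) ^ 2 * (m + 1 + n) := by ring
    _ ≤ (1 - k / (2 * n)) * ((n - (x + 2)) ^ 2 * (m + 1)) := main
    _ ≤ Real.exp (-(k / (2 * n))) * ((n - (x + 2)) ^ 2 * (m + 1)) := by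
        gcongr; exact one_sub_div_le_exp n k
    _ ≤ Real.exp (-(k / (2 * n))) * ((n - x) * (n - x - 1) * (m + 1)) := by
        gcongr; nlinarith
    _ = _ := by ring

/-- Below the golden ratio threshold the fibre sizes grow geometrically for `m` up to the
critical number of pairs. -/
lemma card_fiber_le_succ {n t m a : ℕ} {k : ℝ} (hn : 0 < n) (hk : 0 ≤ k)
    (ht : (t : ℝ) ≤ Real.goldenRatio * n - k) (ha : 4 * (a : ℝ) ≤ k) (hm : m + 1 + n ≤ t + a) :
    (#{C ∈ finAntidiagonal n t | ∑ v, C v / 2 = m} : ℝ) ≤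
      Real.exp (-(k / (2 * n))) * #{C ∈ finAntidiagonal n t | ∑ v, C v / 2 = m + 1} := by
  have hβ : 0 < Real.goldenRatio - 1 := by linarith [Real.one_lt_goldenRatio]
  have hn' : (0 : ℝ) < n := by exact_mod_cast hn
  have hm' : (m : ℝ) + 1 + n ≤ t + a := by exact_mod_cast hm
  -- As `γ < 2`, there are enough pebbles for `m + 1` pairs.
  have hge : 2 * (m + 1) ≤ t := by
    have : (2 * (m + 1) : ℝ) ≤ t := by nlinarith [Real.goldenRatio_lt_two]
    exact_mod_cast this
  obtain ⟨x, rfl⟩ : ∃ x, t = x + 2 * (m + 1) := ⟨t - 2 * (m + 1), by omega⟩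
  rw [card_filter_sum_div_two, show x + 2 * (m + 1) = x + 2 + 2 * m by ring,
    card_filter_sum_div_two]
  rcases le_or_gt n x with hnx | hxn'
  · rw [Nat.choose_eq_zero_of_lt (show n < x + 2 by omega), zero_mul, Nat.cast_zero]
    positivity
  have hxn : (x : ℝ) + 1 ≤ n := by exact_mod_cast hxn'
  push_cast at ht hm'
  have main := sq_mul_le_of_le_sub (s := m + 1) (u := n - x) hβ goldenRatio_sub_one_sq hn' hk
    (by linarith) (by linarith) (by positivity) (by linarith)
  have step := choose_mul_multichoose_step_real (m := m) (show x < n by omega)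
  have hpos : (0 : ℝ) < (x + 1) * (x + 2) * (m + n) := by positivity
  refine le_of_mul_le_mul_left ?_ hpos
  rw [step, ← mul_assoc]
  refine mul_le_mul_of_nonneg_right ?_ (Nat.cast_nonneg _)
  have hx0 : (0 : ℝ) ≤ x := Nat.cast_nonneg x
  have hm0 : (0 : ℝ) ≤ m := Nat.cast_nonneg m
  calc ((n : ℝ) - x) * (n - x - 1) * (m + 1) ≤ (n - x) * (n - x) * (m + 1) := by
        have h0 : (0 : ℝ) ≤ n - x := by linarith
        exact mul_le_mul_of_nonneg_right
          (mul_le_mul_of_nonneg_left (sub_le_self _ zero_le_one) h0) (by positivity)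
    _ = (n - x) ^ 2 * (m + 1) := by ring
    _ ≤ (1 - k / (2 * n)) * ((n - (n - x)) ^ 2 * (m + 1 + n)) := main
    _ ≤ Real.exp (-(k / (2 * n))) * ((n - (n - x)) ^ 2 * (m + 1 + n)) := by
        gcongr; exact one_sub_div_le_exp n k
    _ ≤ Real.exp (-(k / (2 * n))) * ((x + 1) * (x + 2) * (m + n)) := by
        refine mul_le_mul_of_nonneg_left ?_ (Real.exp_nonneg _)
        nlinarith [mul_nonneg hx0 hm0, mul_le_mul_of_nonneg_left hxn hx0]
    _ = _ := by ring

end Ratio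

/-! ### Exponential tail bounds -/

section Tail

lemma exp_pow_floor_le {n : ℕ} {k : ℝ} (hk : 8 ≤ k) :
    Real.exp (-(k / (2 * n))) ^ ⌊k / 4⌋₊ ≤ Real.exp (-(k ^ 2 / (16 * n))) := by
  rw [← Real.exp_nat_mul, Real.exp_le_exp]
  -- `k ≥ 8` gives `k/4 - 1 ≥ k/8`.
  have h : k / 8 ≤ ⌊k / 4⌋₊ := by linarith [Nat.lt_floor_add_one (k / 4)]
  calc (⌊k / 4⌋₊ : ℝ) * -(k / (2 * n)) = -(⌊k / 4⌋₊ * (k / (2 * n))) := by ring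
    _ ≤ -(k / 8 * (k / (2 * n))) := by gcongr
    _ = _ := by rw [div_mul_div_comm]; ring_nf

lemma probCoverSolvable_le_of_le_sub {n t : ℕ} {k : ℝ} (hn : 0 < n) (hk : 8 ≤ k)
    (ht : (t : ℝ) ≤ Real.goldenRatio * n - k) :
    probCoverSolvable n t ≤ Real.exp (-(k ^ 2 / (16 * n))) := by
  set a := ⌊k / 4⌋₊
  have ha : 4 * (a : ℝ) ≤ k := by linarith [Nat.floor_le (show 0 ≤ k / 4 by linarith)]
  refine le_trans ?_ (exp_pow_floor_le hk)
  have hS : (0 : ℝ) < #(finAntidiagonal n t) := by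
    exact_mod_cast (finAntidiagonal_nonempty hn t).card_pos
  rw [probCoverSolvable_eq_div, div_le_iff₀ hS]
  refine card_filter_le_mul_card _ (fun C : Fin n → ℕ => ∑ v, C v / 2) (fun m => m + n ≤ t)
    (fun m => m + a) (add_left_injective a).injOn _ (by positivity) fun m hm => ?_
  have key : ∀ j ≤ a, (#{C ∈ finAntidiagonal n t | ∑ v, C v / 2 = m} : ℝ) ≤
      Real.exp (-(k / (2 * n))) ^ j * #{C ∈ finAntidiagonal n t | ∑ v, C v / 2 = m + j} := by
    intro j
    induction j with
    | zero => simp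
    | succ j ih =>
      intro hj
      refine (ih (by omega)).trans ?_
      rw [pow_succ, mul_assoc]
      gcongr
      exact card_fiber_le_succ hn (by linarith) ht ha (by omega)
  exact key a le_rfl

lemma one_sub_probCoverSolvable_le_of_add_le {n t : ℕ} {k : ℝ} (hn : 0 < n) (hk : 8 ≤ k)
    (ht : Real.goldenRatio * n + k ≤ t) :
    1 - probCoverSolvable n t ≤ Real.exp (-(k ^ 2 / (16 * n))) := by
  set a := ⌊k / 4⌋₊
  have ha : 4 * (a : ℝ) ≤ k := by linarith [Nat.floor_le (show 0 ≤ k / 4 by linarith)]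
  refine le_trans ?_ (exp_pow_floor_le hk)
  have hS : (0 : ℝ) < #(finAntidiagonal n t) := by
    exact_mod_cast (finAntidiagonal_nonempty hn t).card_pos
  -- Unsolvable fibres have `m > t - n ≥ a`, so the truncated shift `m - a` is injective on them.
  have hant : n + a ≤ t := by
    have : (n + a : ℝ) ≤ t := by
      have : (n : ℝ) ≤ Real.goldenRatio * n :=
        le_mul_of_one_le_left n.cast_nonneg Real.one_lt_goldenRatio.le
      linarith
    exact_mod_cast this
  have hcompl : (#{C ∈ finAntidiagonal n t | ∑ v, C v / 2 + n ≤ t} : ℝ) +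
      #{C ∈ finAntidiagonal n t | ¬ ∑ v, C v / 2 + n ≤ t} = #(finAntidiagonal n t) := by
    exact_mod_cast card_filter_add_card_filter_not _
  rw [probCoverSolvable_eq_div, one_sub_div hS.ne', div_le_iff₀ hS, ← hcompl, add_sub_cancel_left,
    hcompl]
  refine card_filter_le_mul_card _ (fun C : Fin n → ℕ => ∑ v, C v / 2) (fun m => ¬ m + n ≤ t)
    (fun m => m - a) ?_ _ (by positivity) fun m hm => ?_
  · intro m hm m' hm' h
    simp only [Set.mem_ofPred_eq] at hm hm' h
    omega
  have key : ∀ j ≤ a, (#{C ∈ finAntidiagonal n t | ∑ v, C v / 2 = m} : ℝ) ≤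
      Real.exp (-(k / (2 * n))) ^ j * #{C ∈ finAntidiagonal n t | ∑ v, C v / 2 = m - j} := by
    intro j
    induction j with
    | zero => simp
    | succ j ih =>
      intro hj
      refine (ih (by omega)).trans ?_
      rw [pow_succ, mul_assoc]
      gcongr
      have h := card_fiber_succ_le (m := m - (j + 1)) hn (by linarith) ht ha (by omega)
      rwa [show m - (j + 1) + 1 = m - j by omega] at h
  exact key a le_rfl

lemma probCoverSolvable_nonneg (n t : ℕ) : 0 ≤ probCoverSolvable n t := measureReal_nonneg

lemma probCoverSolvable_le_one (n t : ℕ) : probCoverSolvable n t ≤ 1 := by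
  rw [probCoverSolvable_eq_div]
  exact div_le_one_of_le₀ (by exact_mod_cast card_filter_le _ _) (Nat.cast_nonneg _)

end Tail

end CoverPebbling

/-! ### Passage to the limit -/

lemma tendsto_exp_neg_sq_div {φ : ℕ → ℝ} (hφ : Tendsto φ atTop atTop) :
    Tendsto (fun n : ℕ => Real.exp (-(((φ n - 1) * √(n : ℝ)) ^ 2 / (16 * n)))) atTop (𝓝 0) := by
  have h1 : Tendsto (fun n => (φ n - 1) ^ 2 / 16) atTop atTop :=
    ((tendsto_pow_atTop two_ne_zero).comp
      (tendsto_atTop_add_const_right _ (-1) hφ)).atTop_div_const (by norm_num)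
  refine (Real.tendsto_exp_neg_atTop_nhds_zero.comp h1).congr' ?_
  filter_upwards [eventually_gt_atTop 0] with n hn
  have hn' : (0 : ℝ) < n := by exact_mod_cast hn
  simp only [Function.comp_apply]
  rw [mul_pow, Real.sq_sqrt hn'.le]
  congr 2
  field_simp

/-- Rounding costs less than `1 ≤ √n`, which is absorbed by replacing `φ` with `φ - 1`. -/
lemma eventually_le_sub_one_mul_sqrt {φ : ℕ → ℝ} (hφ : Tendsto φ atTop atTop) :
    ∀ᶠ n : ℕ in atTop, 0 < n ∧ 8 ≤ (φ n - 1) * √(n : ℝ) ∧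
      (φ n - 1) * √(n : ℝ) ≤ φ n * √(n : ℝ) - 1 := by
  filter_upwards [eventually_gt_atTop 0, hφ.eventually_ge_atTop 9] with n hn h9
  have h1 : 1 ≤ √(n : ℝ) := Real.one_le_sqrt.2 (by exact_mod_cast hn)
  exact ⟨hn, by nlinarith, by linarith⟩

theorem theorem6 (φ : ℕ → ℝ) (hφ : Tendsto φ atTop atTop) (t : ℕ → ℕ) :
    ((∀ᶠ n : ℕ in atTop, |(t n : ℝ) - (Real.goldenRatio * n + φ n * √(n : ℝ))| < 1) →
      Tendsto (fun n => CoverPebbling.probCoverSolvable n (t n)) atTop (𝓝 1)) ∧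
    ((∀ᶠ n : ℕ in atTop, |(t n : ℝ) - (Real.goldenRatio * n - φ n * √(n : ℝ))| < 1) →
      Tendsto (fun n => CoverPebbling.probCoverSolvable n (t n)) atTop (𝓝 0)) := by
  constructor
  · intro ht
    have hlim := (tendsto_exp_neg_sq_div hφ).const_sub 1
    rw [sub_zero] at hlim
    refine tendsto_of_tendsto_of_tendsto_of_le_of_le' hlim tendsto_const_nhds ?_
      (.of_forall fun n => CoverPebbling.probCoverSolvable_le_one n (t n))
    filter_upwards [ht, eventually_le_sub_one_mul_sqrt hφ] with n htn ⟨hn, hk, hk'⟩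
    rw [abs_lt] at htn
    linarith [CoverPebbling.one_sub_probCoverSolvable_le_of_add_le (t := t n) hn hk (by linarith)]
  · intro ht
    refine tendsto_of_tendsto_of_tendsto_of_le_of_le' tendsto_const_nhds
      (tendsto_exp_neg_sq_div hφ)
      (.of_forall fun n => CoverPebbling.probCoverSolvable_nonneg n (t n)) ?_
    filter_upwards [ht, eventually_le_sub_one_mul_sqrt hφ] with n htn ⟨hn, hk, hk'⟩
    rw [abs_lt] at htn
    exact CoverPebbling.probCoverSolvable_le_of_le_sub hn hk (by linarith)
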